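/- Let $G=\operatorname{PSL}_2(\mathbb{C})$ be the group of orientation preserving isometries of hyperbolic space $\mathbb{H}^3=\{(z,t): z\in\mathbb{C},\ t>0\}$, with boundary $\partial\mathbb{H}^3=\mathbb{C}\cup\{\infty\}$ on which $G$ acts by Möbius transformations. Let $o=(0,1)$, let $K$ be the stabilizer of $o$ in $G$ (the image of $\operatorname{SU}(2)$), let $v_0$ be the upward pointing unit tangent vector at $o$, let $A=\{a_t=\pm\operatorname{diag}(e^{t/2},e^{-t/2}):t\in\mathbb{R}\}$ and let $M$ be the stabilizer of $v_0$ in $K$. Put $$N^+=\{h\in G: a_{-t}ha_t\to e \text{ as } t\to-\infty\},\qquad N^-=\{n\in G: a_{-t}na_t\to e\text{ as } t\to+\infty\}.$$ For $g\in G$ let $g^+=g(\infty)$ and $g^-=g(0)$ be the forward and backward end points of the geodesic with initial vector $gv_0$. Let $\Gamma<G$ be a discrete subgroup with limit set $\Lambda(\Gamma)\subset\partial\mathbb{H}^3$ (the set of accumulation points in $\partial\mathbb{H}^3$ of the orbit $\Gamma o$), and suppose that $\Gamma$ is non-elementary, i.e. that $\Lambda(\Gamma)$ has more than two points ($\Gamma$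 need not be Zariski dense). Put $$S_\Gamma=\operatorname{supp}(m^{\mathrm{BMS}})=\{g\in G: g^+\in\Lambda(\Gamma)\text{ and }g^-\in\Lambda(\Gamma)\}.$$ For $g,g'\in S_\Gamma$ say that $g'$ is reachable from $g$ if there are $k\ge 0$, $h_1,\dots,h_k\in N^-\cup N^+$ and $\gamma\in\Gamma$ with $gh_1\cdots h_r\in S_\Gamma$ for all $0\le r\le k$ and $\gamma gh_1\cdots h_k=g'$. For $g\in S_\Gamma$ define the transitivity group $$\mathcal{H}_\Gamma(g)=\{(m,a)\in M\times A: gma\text{ is reachable from }g\}$$ and the weak transitivity group $\mathcal{H}^w_\Gamma(g)\subset M$, the projection of $\mathcal{H}_\Gamma(g)$ to $M$. Then for every $g\in S_\Gamma$ $$\overline{\mathcal{H}_\Gamma(g)}=\overline{\mathcal{H}^w_\Gamma(g)}\times A,$$ where the closures are taken in $M\times A$ and in $M$ respectively. -/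

import Mathlib

open scoped MatrixGroups LinearAlgebra.Projectivization Topology
open Filter OnePoint

namespace FrameFlow

noncomputable section

/-- The group of orientation preserving isometries of hyperbolic three-space, with its Lie group
topology (the quotient of the topology that `SL(2, ℂ)` has as a space of matrices). -/
abbrev PSL2C : Type := PSL(2, ℂ)

/-! ### Hyperbolic three-space in the upper half-space model, its boundary, and limit sets -/

/-- The action of `SL(2, ℂ)` on the upper half-space `ℍ³ = {(z, t) ∈ ℂ × ℝ : 0 < t}` by
orientation preserving isometries of the metric `(|dz|² + dt²) / t²`: the Poincaré extension
`(z, t) ↦ (((a z + b) * conj (c z + d) + a * conj c * t²) / D, t / D)`,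
`D = |c z + d|² + |c|² t²`, of the Möbius transformation `z ↦ (a z + b) / (c z + d)`. -/
def poincareExtension (g : SL(2, ℂ)) (p : ℂ × ℝ) : ℂ × ℝ :=
  let D : ℝ := ‖g 1 0 * p.1 + g 1 1‖ ^ 2 + ‖g 1 0‖ ^ 2 * p.2 ^ 2
  (((g 0 0 * p.1 + g 0 1) * starRingEnd ℂ (g 1 0 * p.1 + g 1 1)
      + g 0 0 * starRingEnd ℂ (g 1 0) * (p.2 : ℂ) ^ 2) / (D : ℂ),
    p.2 / D)

/-- The base point `o = (0, 1)` of the upper half-space; its stabilizer is the image of `SU(2)`. -/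
def basePoint : ℂ × ℝ := (0, 1)

/-- The orbit `Γ o`. As `± g` act in the same way on the upper half-space, it does not matter that
all representatives of the elements of `Γ` are used. -/
def baseOrbit (Γ : Subgroup PSL2C) : Set (ℂ × ℝ) :=
  {p | ∃ g : SL(2, ℂ), (QuotientGroup.mk g : PSL2C) ∈ Γ ∧ p = poincareExtension g basePoint}

/-- The geometric boundary `ℂ ∪ {∞}` of the upper half-space, inside the one-point
compactification of `ℂ × ℝ`; the closure of the upper half-space in the latter is its usual
compactification by the geometric boundary. -/
def boundaryIncl (ξ : OnePoint ℂ) : OnePoint (ℂ × ℝ) := ξ.map fun z => (z, (0 : ℝ))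

/-- The limit set of `Γ`: the set of accumulation points in the boundary of the orbit `Γ o`. -/
def limitSet (Γ : Subgroup PSL2C) : Set (OnePoint ℂ) :=
  {ξ | AccPt (boundaryIncl ξ) (𝓟 ((fun p : ℂ × ℝ => (p : OnePoint (ℂ × ℝ))) '' baseOrbit Γ))}

/-- `Γ` is non-elementary if its limit set has more than two points. -/
def NonElementary (Γ : Subgroup PSL2C) : Prop := 2 < (limitSet Γ).encard

/-! ### The subgroups `K`, `M`, `A` and the horospherical subgroups `N⁺`, `N⁻` -/

/-- The matrix `diag(exp (t / 2), exp (- t / 2))`. -/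
def aMat (t : ℝ) : SL(2, ℂ) :=
  ⟨!![Complex.exp ((t : ℂ) / 2), 0; 0, Complex.exp (-((t : ℂ) / 2))], by
    rw [Matrix.det_fin_two_of, ← Complex.exp_add]; simp⟩

theorem aMat_add (s t : ℝ) : aMat (s + t) = aMat s * aMat t := by
  apply Subtype.ext
  rw [Matrix.SpecialLinearGroup.coe_mul]
  simp [aMat, ← Complex.exp_add, add_div, add_comm]

theorem aMat_zero : aMat 0 = 1 := by
  apply Subtype.ext
  rw [Matrix.SpecialLinearGroup.coe_one]
  simp [aMat, Matrix.one_fin_two]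

/-- The one-parameter subgroup `a_t`, the image of `diag(exp (t / 2), exp (- t / 2))`: it moves the
base point with unit speed along the geodesic `a_t o = (0, exp t)`. -/
def aElt (t : ℝ) : PSL2C := QuotientGroup.mk (aMat t)

theorem aElt_add (s t : ℝ) : aElt (s + t) = aElt s * aElt t := by
  rw [aElt, aMat_add]; rfl

theorem aElt_zero : aElt 0 = 1 := by
  rw [aElt, aMat_zero]; rfl

/-- The group `A = {a_t : t ∈ ℝ}`. -/
def A : Subgroup PSL2C where
  carrier := Set.range aElt
  mul_mem' := by
    rintro _ _ ⟨s, rfl⟩ ⟨t, rfl⟩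
    exact ⟨s + t, aElt_add s t⟩
  one_mem' := ⟨0, aElt_zero⟩
  inv_mem' := by
    rintro _ ⟨t, rfl⟩
    refine ⟨-t, eq_inv_of_mul_eq_one_left ?_⟩
    rw [← aElt_add, neg_add_cancel, aElt_zero]

/-- The group `SU(2)`. Its image `K` in `PSL(2, ℂ)` is the stabilizer of the base point, a maximal
compact subgroup. -/
def SU2 : Subgroup SL(2, ℂ) where
  carrier := {k | (k : Matrix (Fin 2) (Fin 2) ℂ) ∈ Matrix.unitaryGroup (Fin 2) ℂ}
  mul_mem' := fun {a b} ha hb => by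
    change ((a * b : SL(2, ℂ)) : Matrix (Fin 2) (Fin 2) ℂ) ∈ Matrix.unitaryGroup (Fin 2) ℂ
    rw [Matrix.SpecialLinearGroup.coe_mul]
    exact mul_mem ha hb
  one_mem' := by
    change ((1 : SL(2, ℂ)) : Matrix (Fin 2) (Fin 2) ℂ) ∈ Matrix.unitaryGroup (Fin 2) ℂ
    rw [Matrix.SpecialLinearGroup.coe_one]
    exact one_mem _
  inv_mem' := fun {a} ha => by
    change ((a⁻¹ : SL(2, ℂ)) : Matrix (Fin 2) (Fin 2) ℂ) ∈ Matrix.unitaryGroup (Fin 2) ℂ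
    have h1 : (a : Matrix (Fin 2) (Fin 2) ℂ) ∈ Matrix.unitaryGroup (Fin 2) ℂ := ha
    have h2 : ((a⁻¹ : SL(2, ℂ)) : Matrix (Fin 2) (Fin 2) ℂ) * (a : Matrix (Fin 2) (Fin 2) ℂ) = 1 := by
      rw [← Matrix.SpecialLinearGroup.coe_mul, inv_mul_cancel, Matrix.SpecialLinearGroup.coe_one]
    rw [left_inv_eq_right_inv h2 (Unitary.mul_star_self_of_mem h1)]
    exact Unitary.star_mem h1

/-- The unit tangent vector `v₀` at the base point. The tangent space there is the space of
traceless Hermitian matrices, on which the stabilizer of the base point acts by conjugation, and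
`v₀` is the initial velocity of the geodesic `a_t o`, where `a_t = exp (t v₀)`. -/
def baseVector : Matrix (Fin 2) (Fin 2) ℂ := !![1 / 2, 0; 0, -1 / 2]

/-- The group of all `g` that fix `v₀` under conjugation (written without the inverse). -/
def conjStabilizer : Subgroup SL(2, ℂ) where
  carrier := {g | (g : Matrix (Fin 2) (Fin 2) ℂ) * baseVector
    = baseVector * (g : Matrix (Fin 2) (Fin 2) ℂ)}
  mul_mem' := fun {a b} ha hb => by
    change ((a * b : SL(2, ℂ)) : Matrix (Fin 2) (Fin 2) ℂ) * baseVector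
      = baseVector * ((a * b : SL(2, ℂ)) : Matrix (Fin 2) (Fin 2) ℂ)
    rw [Matrix.SpecialLinearGroup.coe_mul]
    exact Commute.mul_left (show Commute _ _ from ha) (show Commute _ _ from hb)
  one_mem' := by
    change ((1 : SL(2, ℂ)) : Matrix (Fin 2) (Fin 2) ℂ) * baseVector
      = baseVector * ((1 : SL(2, ℂ)) : Matrix (Fin 2) (Fin 2) ℂ)
    rw [Matrix.SpecialLinearGroup.coe_one, one_mul, mul_one]
  inv_mem' := fun {a} ha => by
    change ((a⁻¹ : SL(2, ℂ)) : Matrix (Fin 2) (Fin 2) ℂ) * baseVector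
      = baseVector * ((a⁻¹ : SL(2, ℂ)) : Matrix (Fin 2) (Fin 2) ℂ)
    have h1 : (a : Matrix (Fin 2) (Fin 2) ℂ) * baseVector
      = baseVector * (a : Matrix (Fin 2) (Fin 2) ℂ) := ha
    have h2 : ((a⁻¹ : SL(2, ℂ)) : Matrix (Fin 2) (Fin 2) ℂ) * (a : Matrix (Fin 2) (Fin 2) ℂ) = 1 := by
      rw [← Matrix.SpecialLinearGroup.coe_mul, inv_mul_cancel, Matrix.SpecialLinearGroup.coe_one]
    have h3 : (a : Matrix (Fin 2) (Fin 2) ℂ) * ((a⁻¹ : SL(2, ℂ)) : Matrix (Fin 2) (Fin 2) ℂ) = 1 := by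
      rw [← Matrix.SpecialLinearGroup.coe_mul, mul_inv_cancel, Matrix.SpecialLinearGroup.coe_one]
    calc ((a⁻¹ : SL(2, ℂ)) : Matrix (Fin 2) (Fin 2) ℂ) * baseVector
        = ((a⁻¹ : SL(2, ℂ)) : Matrix (Fin 2) (Fin 2) ℂ) * (baseVector
            * (a : Matrix (Fin 2) (Fin 2) ℂ)) * ((a⁻¹ : SL(2, ℂ)) : Matrix (Fin 2) (Fin 2) ℂ) := by
          rw [mul_assoc, mul_assoc, h3, mul_one]
      _ = baseVector * ((a⁻¹ : SL(2, ℂ)) : Matrix (Fin 2) (Fin 2) ℂ) := by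
          rw [← h1, ← mul_assoc, h2, one_mul]

/-- The group `M`: the stabilizer of `v₀` in the image `K` of `SU(2)`. -/
def M : Subgroup PSL2C :=
  (SU2 ⊓ conjStabilizer).map (QuotientGroup.mk' (Subgroup.center SL(2, ℂ)))

/-- The expanding horospherical group `N⁺`. -/
def Nplus : Set PSL2C := {h | Tendsto (fun t : ℝ => aElt (-t) * h * aElt t) atBot (𝓝 1)}

/-- The contracting horospherical group `N⁻`. -/
def Nminus : Set PSL2C := {n | Tendsto (fun t : ℝ => aElt (-t) * n * aElt t) atTop (𝓝 1)}

/-! ### The support of the Bowen-Margulis-Sullivan measure and the transitivity groups -/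

/-- The Möbius action of `PSL(2, ℂ)` on the boundary `ℂ ∪ {∞}`, identified with the projective
line in the usual way (`z` corresponds to `[z : 1]` and `∞` to `[1 : 0]`). -/
def moebius (g : PSL2C) (ξ : OnePoint ℂ) : OnePoint ℂ :=
  (equivProjectivization ℂ).symm (g • equivProjectivization ℂ ξ)

/-- The forward end point `g⁺ = g (v₀⁺)` of `g v₀`, where `v₀⁺ = ∞` is the forward end point of
the geodesic `t ↦ a_t o = (0, exp t)`. -/
def endPlus (g : PSL2C) : OnePoint ℂ := moebius g ∞

/-- The backward end point `g⁻ = g (v₀⁻)` of `g v₀`, where `v₀⁻ = 0` is the backward end point of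
the geodesic `t ↦ a_t o = (0, exp t)`. -/
def endMinus (g : PSL2C) : OnePoint ℂ := moebius g ((0 : ℂ) : OnePoint ℂ)

/-- The support of the Bowen-Margulis-Sullivan measure, lifted to the group: the set of all `g`
such that both end points of `g v₀` lie in the limit set. -/
def suppBMS (Γ : Subgroup PSL2C) : Set PSL2C := {g | endPlus g ∈ limitSet Γ ∧ endMinus g ∈ limitSet Γ}

/-- `g'` is reachable from `g`: both lie in the support, and there are `h₁, …, h_k ∈ N⁻ ∪ N⁺` and
`γ ∈ Γ` such that `g h₁ ⋯ h_r` lies in the support for `0 ≤ r ≤ k` and `γ g h₁ ⋯ h_k = g'`. -/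
def Reachable (Γ : Subgroup PSL2C) (g g' : PSL2C) : Prop :=
  g ∈ suppBMS Γ ∧ g' ∈ suppBMS Γ ∧
    ∃ (l : List PSL2C) (γ : PSL2C), γ ∈ Γ ∧ (∀ h ∈ l, h ∈ Nminus ∪ Nplus) ∧
      (∀ r ≤ l.length, g * (l.take r).prod ∈ suppBMS Γ) ∧ γ * g * l.prod = g'

/-- The transitivity group `{(m, a) ∈ M × A : g m a is reachable from g}` of `Γ` at `g`
(as a set). -/
def transitivityGroup (Γ : Subgroup PSL2C) (g : PSL2C) : Set (M × A) :=
  {x | Reachable Γ g (g * (x.1 : PSL2C) * (x.2 : PSL2C))}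

/-- The weak transitivity group: the projection of the transitivity group to `M`. -/
def weakTransitivityGroup (Γ : Subgroup PSL2C) (g : PSL2C) : Set M :=
  Prod.fst '' transitivityGroup Γ g

end

end FrameFlow

/-! Use the boundary coordinate in which the end points of a frame `P` are ∞ and 0. Right
multiplication by an upper unipotent matrix moves only the backward end point, by a lower unipotent
one only the forward end point. If x ≠ y are limit points in this coordinate and x ≠ 0, the pair of
end points can run through (∞, 0), (∞, y), (x, y), (x, 0), (∞, 0) without leaving the limit set. The
holonomy of this loop is the complex translation by w = -2 log(1 - y/x) along the geodesic
(`reflTransGen_horoStep_diagExp`). Sliding along the geodesic rescales the coordinate but not y/x,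
so such translations compose and generate an additive subgroup of ℂ (`horoPeriods`).

As Γ is non-elementary, its limit set accumulates at 0 (`exists_small_mem_limitSet`), and by
compactness of the circle two limit points near 0 have nearly equal arguments and a tiny ratio y/x
(`exists_div_near_pos`). Then w ≈ 2y/x is short and almost real (`log_one_sub_near_real`), and its
integer multiples approximate every real number (`ofReal_mem_closure`). Hence, up to closure, the
A-component of an element of the transitivity group can be changed at will with its M-component
fixed; the other inclusion is formal.

Limit points are handled by linear algebra: they are the lines spanned by v for which multiples of
lifts of elements of Γ, with factors tending to 0, converge to some v wᵀ ≠ 0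
(`mem_limitSet_of_tendsToRankOne`, `exists_tendsToRankOne`). -/

namespace FrameFlow

noncomputable section

open Matrix

/-! ### Homogeneous coordinates on the boundary -/

/-- The boundary point with homogeneous coordinates `v`. -/
def boundaryPt (v : Fin 2 → ℂ) : OnePoint ℂ :=
  if v 1 = 0 then ∞ else ((v 0 / v 1 : ℂ) : OnePoint ℂ)

theorem exists_boundaryPt (ξ : OnePoint ℂ) : ∃ v : Fin 2 → ℂ, v ≠ 0 ∧ boundaryPt v = ξ := by
  induction ξ using OnePoint.rec with
  | infty => exact ⟨![1, 0], by simp, by simp [boundaryPt]⟩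
  | coe z => exact ⟨![z, 1], by simp, by simp [boundaryPt]⟩

theorem ne_zero_iff_fin_two {v : Fin 2 → ℂ} : v ≠ 0 ↔ v 0 ≠ 0 ∨ v 1 ≠ 0 := by
  rw [Ne, funext_iff, Fin.forall_fin_two, not_and_or]; rfl

theorem boundaryPt_eq_iff {v w : Fin 2 → ℂ} (hv : v ≠ 0) (hw : w ≠ 0) :
    boundaryPt v = boundaryPt w ↔ v 0 * w 1 = w 0 * v 1 := by
  rw [ne_zero_iff_fin_two] at hv hw
  by_cases h1 : v 1 = 0 <;> by_cases h2 : w 1 = 0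
  · simp [boundaryPt, h1, h2]
  · simp_all [boundaryPt]
  · simp_all [boundaryPt]
  · simp [boundaryPt, h1, h2, div_eq_div_iff]

theorem exists_smul_of_boundaryPt_eq {v w : Fin 2 → ℂ} (hv : v ≠ 0) (hw : w ≠ 0)
    (h : boundaryPt v = boundaryPt w) : ∃ c : ℂ, c ≠ 0 ∧ w = c • v := by
  rw [boundaryPt_eq_iff hv hw] at h
  have key : ∃ c : ℂ, w = c • v := by
    rcases ne_zero_iff_fin_two.1 hv with h0 | h0
    · refine ⟨w 0 / v 0, funext fun i => ?_⟩
      fin_cases i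
      · simp [h0]
      · simp only [Fin.mk_one, Pi.smul_apply, smul_eq_mul]; field_simp; linear_combination h
    · refine ⟨w 1 / v 1, funext fun i => ?_⟩
      fin_cases i
      · simp only [Fin.zero_eta, Pi.smul_apply, smul_eq_mul]; field_simp; linear_combination -h
      · simp [h0]
  obtain ⟨c, rfl⟩ := key
  exact ⟨c, fun hc => hw (by simp [hc]), rfl⟩

theorem boundaryPt_smul {c : ℂ} (hc : c ≠ 0) (v : Fin 2 → ℂ) :
    boundaryPt (c • v) = boundaryPt v := by
  by_cases h : v 1 = 0
  · simp [boundaryPt, h]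
  · simp [boundaryPt, h, hc, mul_div_mul_left]

theorem smul_zero_coord (g : SL(2, ℂ)) (v : Fin 2 → ℂ) :
    (g • v) 0 = g 0 0 * v 0 + g 0 1 * v 1 := by
  change (g.1 *ᵥ v) 0 = _
  rw [mulVec_fin_two]; rfl

theorem smul_one_coord (g : SL(2, ℂ)) (v : Fin 2 → ℂ) :
    (g • v) 1 = g 1 0 * v 0 + g 1 1 * v 1 := by
  change (g.1 *ᵥ v) 1 = _
  rw [mulVec_fin_two]; rfl

theorem det_eq_one (g : SL(2, ℂ)) : g 0 0 * g 1 1 - g 0 1 * g 1 0 = 1 := by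
  rw [← det_fin_two]; exact g.2

theorem moebius_mk_boundaryPt (g : SL(2, ℂ)) {v : Fin 2 → ℂ} (hv : v ≠ 0) :
    moebius (QuotientGroup.mk g) (boundaryPt v) = boundaryPt (g • v) := by
  have h : ∀ {w : Fin 2 → ℂ} (hw : w ≠ 0),
      (equivProjectivization ℂ).symm (Projectivization.mk ℂ w hw) = boundaryPt w := by
    intro w hw
    rw [equivProjectivization_symm_apply_mk, boundaryPt, div_eq_inv_mul]
  rw [moebius, ← h hv, Equiv.apply_symm_apply, ← h ((smul_ne_zero_iff_ne g).2 hv)]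
  rfl

theorem boundaryIncl_injective : Function.Injective boundaryIncl := by
  intro a b h
  induction a using OnePoint.rec <;> induction b using OnePoint.rec <;>
    simp_all [boundaryIncl]

/-! ### Limit points as limits of rescaled matrices -/

/-- The orbit map `g ↦ g o`, as a function of a multiple of `g` and of the square of the factor. -/
def scaledOrbit (E : Fin 2 → Fin 2 → ℂ) (s : ℝ) : ℂ × ℝ :=
  ((E 0 1 * starRingEnd ℂ (E 1 1) + E 0 0 * starRingEnd ℂ (E 1 0)) /
      ((‖E 1 1‖ ^ 2 + ‖E 1 0‖ ^ 2 : ℝ) : ℂ),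
    s / (‖E 1 1‖ ^ 2 + ‖E 1 0‖ ^ 2))

theorem poincareExtension_basePoint (g : SL(2, ℂ)) {r : ℝ} (hr : r ≠ 0) :
    poincareExtension g basePoint = scaledOrbit (fun i j => r * g i j) (r ^ 2) := by
  have hr' : (r : ℂ) ≠ 0 := by exact_mod_cast hr
  simp only [poincareExtension, scaledOrbit, basePoint, norm_mul, mul_zero, zero_add, mul_pow,
    Complex.norm_real, Real.norm_eq_abs, sq_abs, ← mul_add, map_mul, Complex.conj_ofReal,
    Complex.ofReal_one, one_pow, mul_one]
  refine Prod.ext ?_ ?_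
  · simp only
    rw [show (r : ℂ) * g 0 1 * (r * starRingEnd ℂ (g 1 1)) +
      r * g 0 0 * (r * starRingEnd ℂ (g 1 0)) = (r ^ 2 : ℝ) * (g 0 1 * starRingEnd ℂ (g 1 1) +
        g 0 0 * starRingEnd ℂ (g 1 0)) by push_cast; ring, Complex.ofReal_mul (r ^ 2),
      mul_div_mul_left _ _ (by simpa using hr)]
  · simp only
    rw [← mul_one (r ^ 2), mul_assoc, mul_div_mul_left _ _ (pow_ne_zero 2 hr), one_mul]

theorem continuousAt_scaledOrbit {E : Fin 2 → Fin 2 → ℂ} {s : ℝ} (h : E 1 ≠ 0) :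
    ContinuousAt (fun p : (Fin 2 → Fin 2 → ℂ) × ℝ => scaledOrbit p.1 p.2) (E, s) := by
  have hD : ‖E 1 1‖ ^ 2 + ‖E 1 0‖ ^ 2 ≠ 0 := by
    rcases ne_zero_iff_fin_two.1 h with h | h <;> positivity
  unfold scaledOrbit
  refine ContinuousAt.prodMk (ContinuousAt.div (by fun_prop) (by fun_prop) ?_)
    (ContinuousAt.div (by fun_prop) (by fun_prop) hD)
  exact_mod_cast hD

/-- The multiples `r g` converge, along `F`, to the matrix `v wᵀ` of rank one, with `r` tending
to zero. -/
def TendsToRankOne (F : Filter SL(2, ℂ)) (v w : Fin 2 → ℂ) : Prop :=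
  ∃ r : SL(2, ℂ) → ℝ, Tendsto r F (𝓝 0) ∧
    ∀ i j, Tendsto (fun g : SL(2, ℂ) => (r g : ℂ) * g i j) F (𝓝 (v i * w j))

theorem scaledOrbit_snd_pos (E : Fin 2 → Fin 2 → ℂ) {s : ℝ} (hs : 0 < s) (h : E 1 ≠ 0) :
    0 < (scaledOrbit E s).2 := by
  have hD : 0 < ‖E 1 1‖ ^ 2 + ‖E 1 0‖ ^ 2 := by
    rcases ne_zero_iff_fin_two.1 h with h | h <;> positivity
  exact div_pos hs hD

theorem row_one_ne_zero (g : SL(2, ℂ)) : (fun j => g 1 j) ≠ 0 := by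
  intro h
  have h0 : g 1 0 = 0 := congrFun h 0
  have h1 : g 1 1 = 0 := congrFun h 1
  simpa [h0, h1] using det_eq_one g

theorem poincareExtension_snd_pos (g : SL(2, ℂ)) : 0 < (poincareExtension g basePoint).2 := by
  rw [poincareExtension_basePoint g one_ne_zero]
  refine scaledOrbit_snd_pos _ (by norm_num) ?_
  simpa using row_one_ne_zero g

theorem coe_ne_boundaryIncl {p : ℂ × ℝ} (hp : 0 < p.2) (ξ : OnePoint ℂ) :
    (p : OnePoint (ℂ × ℝ)) ≠ boundaryIncl ξ := by
  induction ξ using OnePoint.rec with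
  | infty => simp [boundaryIncl]
  | coe z =>
    intro h
    have h' : p = (z, 0) := by simpa [boundaryIncl] using h
    simp [h'] at hp

theorem lagrange_identity (a b c d : ℂ) :
    ‖b * starRingEnd ℂ d + a * starRingEnd ℂ c‖ ^ 2 + ‖a * d - b * c‖ ^ 2 =
      (‖a‖ ^ 2 + ‖b‖ ^ 2) * (‖d‖ ^ 2 + ‖c‖ ^ 2) := by
  simp only [← Complex.normSq_eq_norm_sq, Complex.normSq_apply, Complex.add_re, Complex.add_im,
    Complex.sub_re, Complex.sub_im, Complex.mul_re, Complex.mul_im, Complex.conj_re,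
    Complex.conj_im]
  ring

/-- Controls convergence to ∞, where `scaledOrbit` is not continuous: the squared Euclidean length
of an orbit point is the quotient of the squared row lengths. -/
theorem norm_sq_add_sq_scaledOrbit (E : Fin 2 → Fin 2 → ℂ) {s : ℝ}
    (hs : ‖E 0 0 * E 1 1 - E 0 1 * E 1 0‖ = s) (h : E 1 ≠ 0) :
    ‖(scaledOrbit E s).1‖ ^ 2 + (scaledOrbit E s).2 ^ 2 =
      (‖E 0 0‖ ^ 2 + ‖E 0 1‖ ^ 2) * (‖E 1 1‖ ^ 2 + ‖E 1 0‖ ^ 2)⁻¹ := by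
  have hD : 0 < ‖E 1 1‖ ^ 2 + ‖E 1 0‖ ^ 2 := by
    rcases ne_zero_iff_fin_two.1 h with h | h <;> positivity
  have := lagrange_identity (E 0 0) (E 0 1) (E 1 0) (E 1 1)
  rw [hs] at this
  simp only [scaledOrbit, norm_div, Complex.norm_real, Real.norm_eq_abs, abs_of_pos hD, div_pow]
  rw [← add_div, this]
  field_simp

theorem scaledOrbit_rankOne {v w : Fin 2 → ℂ} (hv : v 1 ≠ 0) (hw : w ≠ 0) :
    scaledOrbit (fun i j => v i * w j) 0 = (v 0 / v 1, 0) := by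
  have hD : ‖w 1‖ ^ 2 + ‖w 0‖ ^ 2 ≠ 0 := by
    rcases ne_zero_iff_fin_two.1 hw with h | h <;> positivity
  have hD' : (‖w 1‖ : ℂ) ^ 2 + (‖w 0‖ : ℂ) ^ 2 ≠ 0 := by exact_mod_cast hD
  have hc : starRingEnd ℂ (v 1) ≠ 0 := by simpa using hv
  simp only [scaledOrbit, zero_div, norm_mul, mul_pow, ← mul_add, map_mul]
  refine Prod.ext ?_ rfl
  simp only
  push_cast
  have e : ∀ z : ℂ, (‖z‖ : ℂ) ^ 2 = z * starRingEnd ℂ z := fun z => by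
    rw [Complex.mul_conj, Complex.normSq_eq_norm_sq]; push_cast; rfl
  rw [e, e] at hD'
  rw [e, e, e]
  field_simp

theorem tendsto_scaledOrbit {F : Filter SL(2, ℂ)} {r : SL(2, ℂ) → ℝ} {E : Fin 2 → Fin 2 → ℂ}
    {s : ℝ} (hE : ∀ i j, Tendsto (fun g : SL(2, ℂ) => (r g : ℂ) * g i j) F (𝓝 (E i j)))
    (hr : Tendsto (fun g => r g ^ 2) F (𝓝 s)) (h : E 1 ≠ 0) :
    Tendsto (fun g : SL(2, ℂ) => scaledOrbit (fun i j => (r g : ℂ) * g i j) (r g ^ 2)) F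
      (𝓝 (scaledOrbit E s)) := by
  have ht : Tendsto (fun g : SL(2, ℂ) =>
      (((fun i j => (r g : ℂ) * g i j : Fin 2 → Fin 2 → ℂ)), r g ^ 2)) F (𝓝 (E, s)) :=
    (tendsto_pi_nhds.2 fun i => tendsto_pi_nhds.2 fun j => hE i j).prodMk_nhds hr
  have := (continuousAt_scaledOrbit (s := s) h).tendsto.comp ht
  exact this.congr fun g => by rw [Function.comp_apply]

/-- The limit of g o sees only the column direction v. For v 1 ≠ 0 this is continuity of the orbit
map at the degenerate matrix; for v 1 = 0 the second row becomes negligible against the first, so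
the orbit is unbounded. -/
theorem tendsto_poincareExtension {F : Filter SL(2, ℂ)} {v w : Fin 2 → ℂ} (hv : v ≠ 0)
    (hw : w ≠ 0) (h : TendsToRankOne F v w) :
    Tendsto (fun g => (poincareExtension g basePoint : OnePoint (ℂ × ℝ))) F
      (𝓝 (boundaryIncl (boundaryPt v))) := by
  obtain ⟨r, hr, hE⟩ := h
  have hr0 : ∀ᶠ g in F, r g ≠ 0 := by
    obtain ⟨i, hi⟩ := Function.ne_iff.1 hv
    obtain ⟨j, hj⟩ := Function.ne_iff.1 hw
    filter_upwards [(hE i j).eventually_ne (mul_ne_zero hi hj)] with g hg h0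
    simp [h0] at hg
  have hcongr : (fun g : SL(2, ℂ) => scaledOrbit (fun i j => (r g : ℂ) * g i j) (r g ^ 2)) =ᶠ[F]
      fun g => poincareExtension g basePoint := by
    filter_upwards [hr0] with g hg
    rw [poincareExtension_basePoint g hg]
  have hr2 : Tendsto (fun g => r g ^ 2) F (𝓝 0) := by simpa using hr.pow 2
  by_cases h1 : v 1 = 0
  · have h0 : v 0 ≠ 0 := (ne_zero_iff_fin_two.1 hv).resolve_right (by simpa using h1)
    have hb : boundaryIncl (boundaryPt v) = ∞ := by simp [boundaryPt, h1, boundaryIncl]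
    rw [hb]
    refine OnePoint.tendsto_coe_infty.comp ?_
    rw [coclosedCompact_eq_cocompact, ← Metric.cobounded_eq_cocompact,
      ← tendsto_norm_atTop_iff_cobounded]
    have hN : Tendsto (fun g : SL(2, ℂ) => ‖(r g : ℂ) * g 0 0‖ ^ 2 + ‖(r g : ℂ) * g 0 1‖ ^ 2) F
        (𝓝 (‖v 0 * w 0‖ ^ 2 + ‖v 0 * w 1‖ ^ 2)) :=
      ((hE 0 0).norm.pow 2).add ((hE 0 1).norm.pow 2)
    have hNpos : 0 < ‖v 0 * w 0‖ ^ 2 + ‖v 0 * w 1‖ ^ 2 := by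
      rcases ne_zero_iff_fin_two.1 hw with h | h
      all_goals
        have := norm_pos_iff.2 (mul_ne_zero h0 h)
        positivity
    have hrow : ∀ g : SL(2, ℂ), r g ≠ 0 → (fun j => (r g : ℂ) * g 1 j) ≠ 0 := by
      intro g hg h
      apply row_one_ne_zero g
      funext j
      have := congrFun h j
      simpa [hg] using this
    have hD : Tendsto (fun g : SL(2, ℂ) => ‖(r g : ℂ) * g 1 1‖ ^ 2 + ‖(r g : ℂ) * g 1 0‖ ^ 2) F
        (𝓝[>] 0) := by
      refine tendsto_nhdsWithin_iff.2 ⟨?_, ?_⟩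
      · simpa [h1] using ((hE 1 1).norm.pow 2).add ((hE 1 0).norm.pow 2)
      · filter_upwards [hr0] with g hg
        rcases ne_zero_iff_fin_two.1 (hrow g hg) with h | h
        · have := norm_pos_iff.2 h
          rw [Set.mem_Ioi]; positivity
        · have := norm_pos_iff.2 h
          rw [Set.mem_Ioi]; positivity
    have hQ := hN.pos_mul_atTop hNpos (tendsto_inv_nhdsGT_zero.comp hD)
    -- The factor 2 appears because the norm of ℂ × ℝ is the maximum norm.
    have hS : Tendsto (fun g => 2 * ‖poincareExtension g basePoint‖ ^ 2) F atTop := by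
      refine tendsto_atTop_mono' F ?_ hQ
      filter_upwards [hr0, hcongr] with g hg hc
      rw [← hc]
      have key := norm_sq_add_sq_scaledOrbit (fun i j => (r g : ℂ) * g i j) (s := r g ^ 2) (by
        have : (r g : ℂ) * g 0 0 * (r g * g 1 1) - r g * g 0 1 * (r g * g 1 0) =
            ((r g ^ 2 : ℝ) : ℂ) := by
          push_cast
          linear_combination (r g : ℂ) ^ 2 * det_eq_one g
        rw [this, Complex.norm_real, Real.norm_eq_abs, abs_of_nonneg (sq_nonneg _)])
        (hrow g hg)
      simp only [Function.comp_apply]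
      rw [← key]
      set p := scaledOrbit (fun i j => (r g : ℂ) * g i j) (r g ^ 2)
      have i1 : ‖p.1‖ ^ 2 ≤ ‖p‖ ^ 2 := by gcongr; exact norm_fst_le p
      have i2 : p.2 ^ 2 ≤ ‖p‖ ^ 2 := by
        rw [← sq_abs]; gcongr; exact norm_snd_le p
      linarith
    by_contra hcon
    rw [tendsto_atTop] at hcon
    push Not at hcon
    obtain ⟨B, hB⟩ := hcon
    have := (tendsto_atTop.1 hS (2 * (max B 0) ^ 2 + 1)).and_frequently hB
    obtain ⟨g, hg1, hg2⟩ := this.exists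
    have h3 : ‖poincareExtension g basePoint‖ ≤ max B 0 := hg2.le.trans (le_max_left _ _)
    have h4 : ‖poincareExtension g basePoint‖ ^ 2 ≤ (max B 0) ^ 2 := by gcongr
    linarith
  · have hb : boundaryIncl (boundaryPt v) = ((v 0 / v 1, (0 : ℝ)) : ℂ × ℝ) := by
      simp [boundaryPt, h1, boundaryIncl]
    rw [hb]
    refine (OnePoint.continuous_coe.tendsto _).comp (Tendsto.congr' hcongr ?_)
    rw [← scaledOrbit_rankOne h1 hw]
    refine tendsto_scaledOrbit hE hr2 ?_
    obtain ⟨j, hj⟩ := Function.ne_iff.1 hw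
    exact Function.ne_iff.2 ⟨j, mul_ne_zero h1 hj⟩

theorem mem_limitSet_of_tendsToRankOne {Γ : Subgroup PSL2C} {F : Filter SL(2, ℂ)} [NeBot F]
    (hF : ∀ᶠ g : SL(2, ℂ) in F, (QuotientGroup.mk g : PSL2C) ∈ Γ) {v w : Fin 2 → ℂ} (hv : v ≠ 0)
    (hw : w ≠ 0) (h : TendsToRankOne F v w) : boundaryPt v ∈ limitSet Γ := by
  change AccPt _ _
  rw [accPt_iff_frequently]
  refine (tendsto_poincareExtension hv hw h).frequently (Eventually.frequently ?_)
  filter_upwards [hF] with g hg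
  exact ⟨coe_ne_boundaryIncl (poincareExtension_snd_pos g) _, Set.mem_image_of_mem _ ⟨g, hg, rfl⟩⟩

theorem exists_rankOne {E : Fin 2 → Fin 2 → ℂ} (hE : E ≠ 0)
    (hdet : E 0 0 * E 1 1 - E 0 1 * E 1 0 = 0) :
    ∃ v w : Fin 2 → ℂ, v ≠ 0 ∧ w ≠ 0 ∧ ∀ i j, E i j = v i * w j := by
  obtain ⟨i, hi⟩ := Function.ne_iff.1 hE
  obtain ⟨j, hj⟩ := Function.ne_iff.1 hi
  replace hj : E i j ≠ 0 := hj
  -- The column and the normalized row through a nonzero entry.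
  refine ⟨fun k => E k j, fun l => E i l / E i j, Function.ne_iff.2 ⟨i, hj⟩,
    Function.ne_iff.2 ⟨j, by simp [hj]⟩, fun k l => ?_⟩
  rw [mul_div_assoc', eq_div_iff hj]
  have h2 : ∀ i : Fin 2, i = 0 ∨ i = 1 := by decide
  rcases h2 i with rfl | rfl <;> rcases h2 j with rfl | rfl <;> rcases h2 k with rfl | rfl <;>
    rcases h2 l with rfl | rfl <;>
    first
    | ring1
    | linear_combination (exp := 1) hdet
    | linear_combination (exp := 1) -hdet

/-- Normalized matrices lie in a compact sphere, so they converge along an ultrafilter. The limit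
must be singular, since otherwise the orbit would converge inside hyperbolic space. -/
theorem exists_tendsToRankOne {Γ : Subgroup PSL2C} {v : Fin 2 → ℂ} (hv : v ≠ 0)
    (h : boundaryPt v ∈ limitSet Γ) :
    ∃ (F : Filter SL(2, ℂ)) (w : Fin 2 → ℂ), NeBot F ∧
      (∀ᶠ g : SL(2, ℂ) in F, (QuotientGroup.mk g : PSL2C) ∈ Γ) ∧ w ≠ 0 ∧ TendsToRankOne F v w := by
  let φ : SL(2, ℂ) → OnePoint (ℂ × ℝ) := fun g => (poincareExtension g basePoint : OnePoint (ℂ × ℝ))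
  let S : Set SL(2, ℂ) := {g | (QuotientGroup.mk g : PSL2C) ∈ Γ}
  have hS : (fun p : ℂ × ℝ => (p : OnePoint (ℂ × ℝ))) '' baseOrbit Γ = φ '' S := by
    ext x
    constructor
    · rintro ⟨_, ⟨g, hg, rfl⟩, rfl⟩
      exact ⟨g, hg, rfl⟩
    · rintro ⟨g, hg, rfl⟩
      exact ⟨_, ⟨g, hg, rfl⟩, rfl⟩
  have hacc : NeBot (𝓝[≠] (boundaryIncl (boundaryPt v)) ⊓ 𝓟 (φ '' S)) := hS ▸ h
  have hne := comap_inf_principal_neBot_of_image_mem (m := φ) (s := S) hacc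
    (mem_inf_of_right (mem_principal_self _))
  let F : Ultrafilter SL(2, ℂ) := Ultrafilter.of
    (comap φ (𝓝[≠] (boundaryIncl (boundaryPt v)) ⊓ 𝓟 (φ '' S)) ⊓ 𝓟 S)
  have hFle := Ultrafilter.of_le
    (comap φ (𝓝[≠] (boundaryIncl (boundaryPt v)) ⊓ 𝓟 (φ '' S)) ⊓ 𝓟 S)
  have hFS : ∀ᶠ g : SL(2, ℂ) in F, (QuotientGroup.mk g : PSL2C) ∈ Γ :=
    le_principal_iff.1 (hFle.trans inf_le_right)
  have hFφ : Tendsto φ F (𝓝 (boundaryIncl (boundaryPt v))) :=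
    (tendsto_comap.mono_left (hFle.trans inf_le_left)).mono_right
      (inf_le_left.trans nhdsWithin_le_nhds)
  let c : SL(2, ℂ) → Fin 2 → Fin 2 → ℂ := fun g i j => g i j
  let r : SL(2, ℂ) → ℝ := fun g => ‖c g‖⁻¹
  -- Determinant one forces 1 ≤ 2‖c g‖²; the bound keeps the factors `r g` in a compact interval.
  have hc : ∀ g, 1 / 2 ≤ ‖c g‖ := by
    intro g
    have e : ∀ i j, ‖g i j‖ ≤ ‖c g‖ := fun i j =>
      (norm_le_pi_norm (c g i) j).trans (norm_le_pi_norm (c g) i)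
    have h1 : (1 : ℝ) ≤ ‖g 0 0‖ * ‖g 1 1‖ + ‖g 0 1‖ * ‖g 1 0‖ := by
      calc (1 : ℝ) = ‖g 0 0 * g 1 1 - g 0 1 * g 1 0‖ := by rw [det_eq_one, norm_one]
        _ ≤ _ := by rw [← norm_mul, ← norm_mul]; exact norm_sub_le _ _
    have h2 : ‖g 0 0‖ * ‖g 1 1‖ ≤ ‖c g‖ * ‖c g‖ := by gcongr <;> apply e
    have h3 : ‖g 0 1‖ * ‖g 1 0‖ ≤ ‖c g‖ * ‖c g‖ := by gcongr <;> apply e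
    by_contra hcon
    nlinarith [norm_nonneg (c g)]
  have hcpos : ∀ g, 0 < ‖c g‖ := fun g => by linarith [hc g]
  have hrpos : ∀ g, 0 < r g := fun g => inv_pos.2 (hcpos g)
  have hsph : ∀ᶠ g in F, r g • c g ∈ Metric.sphere (0 : Fin 2 → Fin 2 → ℂ) 1 :=
    Eventually.of_forall fun g => by
      rw [mem_sphere_zero_iff_norm, norm_smul, norm_inv, norm_norm]
      exact inv_mul_cancel₀ (hcpos g).ne'
  have hIcc : ∀ᶠ g in F, r g ∈ Set.Icc (0 : ℝ) 2 := Eventually.of_forall fun g =>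
    ⟨(hrpos g).le, inv_le_of_inv_le₀ (by norm_num) (by simpa using hc g)⟩
  obtain ⟨E, hEs, hE⟩ := (isCompact_sphere (0 : Fin 2 → Fin 2 → ℂ) 1).ultrafilter_le_nhds
    (F.map fun g => r g • c g) (le_principal_iff.2 hsph)
  obtain ⟨r₀, hr₀s, hr₀⟩ := (isCompact_Icc (a := (0 : ℝ)) (b := 2)).ultrafilter_le_nhds
    (F.map r) (le_principal_iff.2 hIcc)
  replace hE : Tendsto (fun g => r g • c g) F (𝓝 E) := hE
  replace hr₀ : Tendsto r F (𝓝 r₀) := hr₀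
  have hEij : ∀ i j, Tendsto (fun g : SL(2, ℂ) => (r g : ℂ) * g i j) F (𝓝 (E i j)) := by
    intro i j
    have := tendsto_pi_nhds.1 (tendsto_pi_nhds.1 hE i) j
    simpa [c] using this
  have hE0 : E ≠ 0 := by
    rintro rfl
    simp at hEs
  have hdet : E 0 0 * E 1 1 - E 0 1 * E 1 0 = (r₀ : ℂ) ^ 2 := by
    refine tendsto_nhds_unique (((hEij 0 0).mul (hEij 1 1)).sub ((hEij 0 1).mul (hEij 1 0))) ?_
    have : Tendsto (fun g => ((r g : ℝ) : ℂ) ^ 2) F (𝓝 ((r₀ : ℂ) ^ 2)) :=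
      ((Complex.continuous_ofReal.tendsto _).comp hr₀).pow 2
    refine this.congr fun g => ?_
    linear_combination -(r g : ℂ) ^ 2 * det_eq_one g
  have hr₀0 : r₀ = 0 := by
    by_contra hr
    have hE1 : E 1 ≠ 0 := by
      intro h1
      have h10 : E 1 0 = 0 := congrFun h1 0
      have h11 : E 1 1 = 0 := congrFun h1 1
      rw [h10, h11, mul_zero, mul_zero, sub_zero] at hdet
      exact hr (by simpa using hdet.symm)
    have ht : Tendsto (fun g => poincareExtension g basePoint) F (𝓝 (scaledOrbit E (r₀ ^ 2))) := by
      refine (tendsto_scaledOrbit hEij (hr₀.pow 2) hE1).congr fun g => ?_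
      rw [poincareExtension_basePoint g (hrpos g).ne']
    exact coe_ne_boundaryIncl (scaledOrbit_snd_pos E (by positivity) hE1) (boundaryPt v)
      (tendsto_nhds_unique ((OnePoint.continuous_coe.tendsto _).comp ht) hFφ)
  rw [hr₀0] at hr₀ hdet
  obtain ⟨v', w', hv', hw', hvw⟩ := exists_rankOne hE0 (by simpa using hdet)
  have hR : TendsToRankOne F v' w' := ⟨r, hr₀, fun i j => hvw i j ▸ hEij i j⟩
  have heq := boundaryIncl_injective
    (tendsto_nhds_unique (tendsto_poincareExtension hv' hw' hR) hFφ)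
  obtain ⟨a, ha, rfl⟩ := exists_smul_of_boundaryPt_eq hv hv' heq.symm
  refine ⟨F, a • w', inferInstance, hFS, smul_ne_zero ha hw', r, hr₀, fun i j => ?_⟩
  have := hEij i j
  rw [hvw] at this
  simpa [mul_assoc, mul_left_comm] using this

/-! ### Invariance and perfectness of the limit set -/

theorem moebius_injective (g : PSL2C) : Function.Injective (moebius g) :=
  (equivProjectivization ℂ).symm.injective.comp
    ((MulAction.injective g).comp (equivProjectivization ℂ).injective)

theorem boundaryPt_smul_injective (g : SL(2, ℂ)) {v w : Fin 2 → ℂ} (hv : v ≠ 0) (hw : w ≠ 0)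
    (h : boundaryPt (g • v) = boundaryPt (g • w)) : boundaryPt v = boundaryPt w := by
  rw [← moebius_mk_boundaryPt g hv, ← moebius_mk_boundaryPt g hw] at h
  exact moebius_injective _ h

theorem TendsToRankOne.map_mul {F : Filter SL(2, ℂ)} {v w : Fin 2 → ℂ}
    (h : TendsToRankOne F v w) (γ : SL(2, ℂ)) :
    TendsToRankOne (F.map (γ * ·)) (γ • v) w := by
  obtain ⟨r, hr, hE⟩ := h
  refine ⟨fun g => r (γ⁻¹ * g), tendsto_map'_iff.2 (hr.congr fun g => ?_), fun i j => ?_⟩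
  · simp
  · have e : (γ • v) i = γ i 0 * v 0 + γ i 1 * v 1 := by
      have h2 : ∀ i : Fin 2, i = 0 ∨ i = 1 := by decide
      rcases h2 i with rfl | rfl
      · exact smul_zero_coord γ v
      · exact smul_one_coord γ v
    rw [tendsto_map'_iff, e, add_mul, mul_assoc, mul_assoc]
    refine (((hE 0 j).const_mul (γ i 0)).add ((hE 1 j).const_mul (γ i 1))).congr fun g => ?_
    simp only [Function.comp_apply, inv_mul_cancel_left]
    have : (γ * g) i j = γ i 0 * g 0 j + γ i 1 * g 1 j := by
      change (γ.1 * g.1) i j = _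
      rw [mul_apply, Fin.sum_univ_two]
    rw [this]
    ring

theorem smul_mem_limitSet {Γ : Subgroup PSL2C} {γ : SL(2, ℂ)}
    (hγ : (QuotientGroup.mk γ : PSL2C) ∈ Γ) {v : Fin 2 → ℂ} (hv : v ≠ 0)
    (h : boundaryPt v ∈ limitSet Γ) : boundaryPt (γ • v) ∈ limitSet Γ := by
  obtain ⟨F, w, hF, hFΓ, hw, hR⟩ := exists_tendsToRankOne hv h
  refine mem_limitSet_of_tendsToRankOne (F := F.map (γ * ·)) ?_ ((smul_ne_zero_iff_ne γ).2 hv) hw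
    (hR.map_mul γ)
  rw [eventually_map]
  filter_upwards [hFΓ] with g hg
  exact Γ.mul_mem hγ hg

/-- The kernel of the linear form w is a single boundary point, so at least two of any three limit
points avoid it. Near v wᵀ, matrices contract everything off this kernel towards v. -/
theorem exists_pair_of_nonElementary {Γ : Subgroup PSL2C} (hΓ : NonElementary Γ)
    {w : Fin 2 → ℂ} (hw : w ≠ 0) :
    ∃ z z' : Fin 2 → ℂ, z ≠ 0 ∧ z' ≠ 0 ∧ boundaryPt z ∈ limitSet Γ ∧ boundaryPt z' ∈ limitSet Γ ∧
      boundaryPt z ≠ boundaryPt z' ∧ w 0 * z 0 + w 1 * z 1 ≠ 0 ∧ w 0 * z' 0 + w 1 * z' 1 ≠ 0 := by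
  obtain ⟨T, hTΛ, hT⟩ := Set.exists_subset_encard_eq (k := 3) (Order.add_one_le_of_lt hΓ)
  obtain ⟨a, b, c, hab, hac, hbc, rfl⟩ := Set.encard_eq_three.1 hT
  have ha : a ∈ limitSet Γ := hTΛ (by simp)
  have hb : b ∈ limitSet Γ := hTΛ (by simp)
  have hc : c ∈ limitSet Γ := hTΛ (by simp)
  clear hT hTΛ
  obtain ⟨a, ha0, rfl⟩ := exists_boundaryPt a
  obtain ⟨b, hb0, rfl⟩ := exists_boundaryPt b
  obtain ⟨c, hc0, rfl⟩ := exists_boundaryPt c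
  have key : ∀ z z' : Fin 2 → ℂ, z ≠ 0 → z' ≠ 0 → boundaryPt z ≠ boundaryPt z' →
      w 0 * z 0 + w 1 * z 1 = 0 → w 0 * z' 0 + w 1 * z' 1 ≠ 0 := by
    intro z z' hz hz' hne h h'
    apply hne
    rw [boundaryPt_eq_iff hz hz']
    rcases ne_zero_iff_fin_two.1 hw with h0 | h0
    · apply mul_left_cancel₀ h0
      linear_combination z' 1 * h - z 1 * h'
    · apply mul_left_cancel₀ h0
      linear_combination z 0 * h' - z' 0 * h
  by_cases h1 : w 0 * a 0 + w 1 * a 1 = 0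
  · exact ⟨b, c, hb0, hc0, hb, hc, hbc, key a b ha0 hb0 hab h1, key a c ha0 hc0 hac h1⟩
  · by_cases h2 : w 0 * b 0 + w 1 * b 1 = 0
    · exact ⟨a, c, ha0, hc0, ha, hc, hac, h1, key b c hb0 hc0 hbc h2⟩
    · exact ⟨a, b, ha0, hb0, ha, hb, hab, h1, h2⟩

/-- The limit set of a non-elementary group accumulates at each of its points: here at `P 0`, in
the coordinate given by `P`. -/
theorem exists_small_mem_limitSet {Γ : Subgroup PSL2C} (hΓ : NonElementary Γ) (P : SL(2, ℂ))
    (hP : boundaryPt (P • ![0, 1]) ∈ limitSet Γ) {ε : ℝ} (hε : 0 < ε) :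
    ∃ y : ℂ, y ≠ 0 ∧ ‖y‖ < ε ∧ boundaryPt (P • ![y, 1]) ∈ limitSet Γ := by
  obtain ⟨F, w, hF, hFΓ, hw, hR⟩ :=
    exists_tendsToRankOne ((smul_ne_zero_iff_ne P).2 (by simp)) hP
  obtain ⟨r, hr, hE⟩ := hR.map_mul P⁻¹
  rw [inv_smul_smul] at hE
  obtain ⟨z, z', hz, hz', hzΛ, hzΛ', hne, hwz, hwz'⟩ := exists_pair_of_nonElementary hΓ hw
  -- After the coordinate change by `P⁻¹` the attracting point is 0, and h = P⁻¹γ contracts each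
  -- point off the kernel of w to it.
  have lim : ∀ z : Fin 2 → ℂ, w 0 * z 0 + w 1 * z 1 ≠ 0 →
      ∀ᶠ h : SL(2, ℂ) in F.map (P⁻¹ * ·), (h • z) 1 ≠ 0 ∧ ‖(h • z) 0 / (h • z) 1‖ < ε := by
    intro z hz
    have l0 : Tendsto (fun h : SL(2, ℂ) => (r h : ℂ) * (h • z) 0) (F.map (P⁻¹ * ·)) (𝓝 0) := by
      have := ((hE 0 0).mul_const (z 0)).add ((hE 0 1).mul_const (z 1))
      simp only [cons_val_zero, zero_mul, add_zero] at this
      refine this.congr fun h => ?_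
      rw [smul_zero_coord]; ring
    have l1 : Tendsto (fun h : SL(2, ℂ) => (r h : ℂ) * (h • z) 1) (F.map (P⁻¹ * ·))
        (𝓝 (w 0 * z 0 + w 1 * z 1)) := by
      have := ((hE 1 0).mul_const (z 0)).add ((hE 1 1).mul_const (z 1))
      simp only [cons_val_one, cons_val_fin_one, one_mul] at this
      refine this.congr fun h => ?_
      rw [smul_one_coord]; ring
    have l2 := (l0.div l1 hz).norm
    rw [zero_div, norm_zero] at l2
    filter_upwards [l1.eventually_ne hz, l2.eventually_lt_const hε] with h h1 h2
    refine ⟨right_ne_zero_of_mul h1, ?_⟩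
    rwa [Pi.div_apply, mul_div_mul_left _ _ (left_ne_zero_of_mul h1)] at h2
  have hΓ' : ∀ᶠ h : SL(2, ℂ) in F.map (P⁻¹ * ·), (QuotientGroup.mk (P * h) : PSL2C) ∈ Γ := by
    rw [eventually_map]
    simpa using hFΓ
  obtain ⟨h, ⟨h1, h2⟩, ⟨h1', h2'⟩, hh⟩ := ((lim z hwz).and ((lim z' hwz').and hΓ')).exists
  have mem : ∀ z : Fin 2 → ℂ, z ≠ 0 → boundaryPt z ∈ limitSet Γ → (h • z) 1 ≠ 0 →
      boundaryPt (P • ![(h • z) 0 / (h • z) 1, 1]) ∈ limitSet Γ := by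
    intro z hz hzΛ h1
    have e : boundaryPt ![(h • z) 0 / (h • z) 1, 1] = boundaryPt (h • z) := by
      simp [boundaryPt, h1]
    rw [← moebius_mk_boundaryPt P (by simp), e,
      moebius_mk_boundaryPt P ((smul_ne_zero_iff_ne h).2 hz), ← mul_smul]
    exact smul_mem_limitSet hh hz hzΛ
  -- Both images are small, and by injectivity of h at most one of them is 0.
  by_cases h0 : (h • z) 0 = 0
  · refine ⟨(h • z') 0 / (h • z') 1, div_ne_zero (fun h0' => hne ?_) h1', h2',
      mem z' hz' hzΛ' h1'⟩
    refine boundaryPt_smul_injective h hz hz' ?_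
    rw [boundaryPt_eq_iff ((smul_ne_zero_iff_ne h).2 hz) ((smul_ne_zero_iff_ne h).2 hz'), h0, h0']
    ring
  · exact ⟨_, div_ne_zero h0 h1, h2, mem z hz hzΛ h1⟩

/-! ### Short, almost real complex numbers -/

/-- An additive subgroup of `ℂ` containing arbitrarily small elements whose direction is
arbitrarily close to that of the real axis is dense along the real axis. -/
theorem ofReal_mem_closure (W : AddSubgroup ℂ)
    (hW : ∀ ε > 0, ∃ w ∈ W, w.re ≠ 0 ∧ ‖w‖ < ε ∧ |w.im| ≤ ε * |w.re|) (s : ℝ) :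
    (s : ℂ) ∈ closure (W : Set ℂ) := by
  rw [Metric.mem_closure_iff]
  intro δ hδ
  -- The multiple m w nearest to s in real part misses s by less than ε/2 in real part and by at
  -- most ε(|s| + 1) in imaginary part.
  set ε := min 1 (δ / (|s| + 3)) with hεdef
  have hs := abs_nonneg s
  have hε : 0 < ε := by positivity
  have hε1 : ε ≤ 1 := min_le_left _ _
  have hε2 : ε * (|s| + 3) ≤ δ := by
    rw [← le_div_iff₀ (by positivity)]; exact min_le_right _ _
  obtain ⟨w, hw, hre, hn, him⟩ := hW ε hε
  have hre' : |w.re| < ε := (Complex.abs_re_le_norm w).trans_lt hn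
  set m : ℤ := round (s / w.re) with hm
  refine ⟨m • w, W.zsmul_mem hw m, ?_⟩
  have hpos : 0 < |w.re| := abs_pos.2 hre
  have h1 : |s - m * w.re| ≤ 1 / 2 * |w.re| := by
    have := mul_le_mul_of_nonneg_right (abs_sub_round (s / w.re)) hpos.le
    rwa [← abs_mul, sub_mul, div_mul_cancel₀ _ hre] at this
  have h2 : |(m : ℝ) * w.im| ≤ ε * (|s| + 1) := by
    have h3 : |(m : ℝ) * w.re| ≤ |s| + 1 := by
      have := abs_sub_abs_le_abs_sub ((m : ℝ) * w.re) s
      rw [abs_sub_comm] at this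
      linarith
    rw [abs_mul] at h3 ⊢
    calc |(m : ℝ)| * |w.im| ≤ |(m : ℝ)| * (ε * |w.re|) := by gcongr
      _ = ε * (|(m : ℝ)| * |w.re|) := by ring
      _ ≤ _ := by gcongr
  rw [Complex.dist_eq]
  refine (Complex.norm_le_abs_re_add_abs_im _).trans_lt ?_
  simp only [zsmul_eq_mul, Complex.sub_re, Complex.sub_im, Complex.ofReal_re, Complex.ofReal_im,
    Complex.mul_re, Complex.mul_im, Complex.intCast_re, Complex.intCast_im, zero_mul, sub_zero,
    add_zero, zero_sub, abs_neg]
  linarith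

/-- Two points of a set accumulating at `0` may be chosen with quotient small and almost a positive
real. -/
theorem exists_div_near_pos {Y : Set ℂ} (hY : ∀ ε > 0, ∃ y ∈ Y, y ≠ 0 ∧ ‖y‖ < ε) {ε : ℝ}
    (hε : 0 < ε) : ∃ x ∈ Y, ∃ y ∈ Y, x ≠ 0 ∧ y ≠ 0 ∧ ‖y / x‖ < ε ∧
      ‖y / x - ‖y / x‖‖ ≤ ε * ‖y / x‖ := by
  choose y hyY hy0 hy using fun n : ℕ => hY (1 / (n + 1)) (by positivity)
  have hyt : Tendsto y atTop (𝓝 0) :=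
    squeeze_zero_norm (fun n => (hy n).le) tendsto_one_div_add_atTop_nhds_zero_nat
  obtain ⟨u, -, φ, hφ, hu⟩ := (isCompact_sphere (0 : ℂ) 1).tendsto_subseq
    (x := fun n => y n / ‖y n‖) (fun n => by
      rw [mem_sphere_zero_iff_norm, norm_div, Complex.norm_real, norm_norm]
      exact div_self (norm_ne_zero_iff.2 (hy0 n)))
  have hu' := Metric.tendsto_atTop.1 hu (ε / 2) (by positivity)
  obtain ⟨k, hk⟩ := hu'
  have hpos : 0 < ‖y (φ k)‖ := norm_pos_iff.2 (hy0 _)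
  -- With x = y (φ k) fixed, the second point is taken so far along the subsequence that the ratio
  -- is small, while both directions stay within ε/2 of u.
  have ht := (hyt.comp hφ.tendsto_atTop).norm.eventually_lt_const
    (u := ε * ‖y (φ k)‖) (by rw [norm_zero]; positivity)
  obtain ⟨n, hn, hnk⟩ := (ht.and (eventually_ge_atTop k)).exists
  simp only [Function.comp_apply] at hn hk
  refine ⟨y (φ k), hyY _, y (φ n), hyY _, hy0 _, hy0 _, ?_, ?_⟩
  · rwa [norm_div, div_lt_iff₀ hpos]
  · have hd : ‖y (φ n) / ‖y (φ n)‖ - y (φ k) / ‖y (φ k)‖‖ ≤ ε := by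
      rw [← dist_eq_norm]
      linarith [dist_triangle_right (y (φ n) / (‖y (φ n)‖ : ℂ)) (y (φ k) / (‖y (φ k)‖ : ℂ)) u,
        hk n hnk, hk k le_rfl]
    have hn0 : (‖y (φ n)‖ : ℂ) ≠ 0 := by simpa using hy0 (φ n)
    have hk0 : (‖y (φ k)‖ : ℂ) ≠ 0 := by simpa using hy0 (φ k)
    have e : y (φ n) / y (φ k) - (‖y (φ n) / y (φ k)‖ : ℝ) =
        (y (φ n) / ‖y (φ n)‖ - y (φ k) / ‖y (φ k)‖) * (‖y (φ n)‖ / y (φ k)) := by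
      rw [norm_div]
      push_cast
      field_simp [hy0 (φ k)]
    rw [e, norm_mul, norm_div, norm_div, Complex.norm_real, norm_norm]
    gcongr

/-- The logarithm of `1 - z` has a direction close to that of the real axis if `z` has. -/
theorem log_one_sub_near_real {z : ℂ} {ε : ℝ} (hε : ε ≤ 1 / 4) (hz0 : z ≠ 0)
    (hz : ‖z‖ < ε) (h : ‖z - ‖z‖‖ ≤ ε * ‖z‖) :
    (-2 * Complex.log (1 - z)).re ≠ 0 ∧ ‖-2 * Complex.log (1 - z)‖ < 4 * ε ∧
      |(-2 * Complex.log (1 - z)).im| ≤ 4 * ε * |(-2 * Complex.log (1 - z)).re| := by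
  have hpos : 0 < ‖z‖ := norm_pos_iff.2 hz0
  have hlog : ‖Complex.log (1 + -z) - -z‖ ≤ ε * ‖z‖ := by
    refine (Complex.norm_log_one_add_sub_self_le (by rw [norm_neg]; linarith)).trans ?_
    rw [norm_neg]
    have h1 : (1 - ‖z‖)⁻¹ ≤ 2 := inv_le_of_inv_le₀ (by norm_num) (by linarith)
    nlinarith [mul_le_mul_of_nonneg_left h1 (sq_nonneg ‖z‖), mul_pos hpos (sub_pos.2 hz)]
  rw [← sub_eq_add_neg] at hlog
  set L := Complex.log (1 - z)
  -- L is close to -z, and z to its modulus; hence Re L ≤ -‖z‖/2, which dominates Im L.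
  have hL : ‖L + ‖z‖‖ ≤ 2 * ε * ‖z‖ := by
    calc ‖L + ‖z‖‖ = ‖(L - -z) - (z - ‖z‖)‖ := by ring_nf
      _ ≤ ‖L - -z‖ + ‖z - ‖z‖‖ := norm_sub_le _ _
      _ ≤ _ := by linarith
  have hre := (Complex.abs_re_le_norm (L + ‖z‖)).trans hL
  have him := (Complex.abs_im_le_norm (L + ‖z‖)).trans hL
  simp only [Complex.add_re, Complex.add_im, Complex.ofReal_re, Complex.ofReal_im, add_zero]
    at hre him
  have hε' : 2 * ε * ‖z‖ ≤ 1 / 2 * ‖z‖ := by nlinarith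
  have hre2 := abs_le.1 hre
  have hneg : L.re < 0 := by linarith
  have e1 : (-2 * L).re = -2 * L.re := by simp
  have e2 : (-2 * L).im = -2 * L.im := by simp
  rw [e1, e2, abs_mul, abs_mul, abs_neg, abs_two, norm_mul, norm_neg, Complex.norm_ofNat]
  have hnL : ‖L‖ < 2 * ε := by
    have := norm_le_norm_add_norm_sub' L (-(‖z‖ : ℂ))
    rw [sub_neg_eq_add, norm_neg, Complex.norm_real, norm_norm] at this
    linarith
  refine ⟨by nlinarith, by linarith, ?_⟩
  rw [abs_of_neg hneg]
  nlinarith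

/-! ### Unipotent and diagonal matrices -/

/-- The upper unipotent matrix with entry `q`. -/
def upperUnip (q : ℂ) : SL(2, ℂ) := ⟨!![1, q; 0, 1], by simp⟩

/-- The lower unipotent matrix with entry `q`. -/
def lowerUnip (q : ℂ) : SL(2, ℂ) := ⟨!![1, 0; q, 1], by simp⟩

/-- The matrix `diag(exp (w / 2), exp (- w / 2))`. -/
def diagExp (w : ℂ) : SL(2, ℂ) :=
  ⟨!![Complex.exp (w / 2), 0; 0, Complex.exp (-(w / 2))], by
    rw [Matrix.det_fin_two_of, ← Complex.exp_add]; simp⟩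

theorem aMat_eq_diagExp (t : ℝ) : aMat t = diagExp t := rfl

theorem upperUnip_neg (q : ℂ) : upperUnip (-q) = (upperUnip q)⁻¹ := by
  refine eq_inv_of_mul_eq_one_left (Subtype.ext ?_)
  change !![1, -q; 0, 1] * !![1, q; 0, 1] = 1
  simp [one_fin_two]

theorem lowerUnip_neg (q : ℂ) : lowerUnip (-q) = (lowerUnip q)⁻¹ := by
  refine eq_inv_of_mul_eq_one_left (Subtype.ext ?_)
  change !![1, 0; -q, 1] * !![1, 0; q, 1] = 1
  simp [one_fin_two]

theorem diagExp_add (v w : ℂ) : diagExp (v + w) = diagExp v * diagExp w := by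
  apply Subtype.ext
  change _ = !![_, _; _, _] * !![_, _; _, _]
  simp [diagExp, ← Complex.exp_add, add_div, add_comm]

theorem diagExp_conj_upperUnip (w q : ℂ) :
    diagExp (-w) * upperUnip q * diagExp w = upperUnip (Complex.exp (-w) * q) := by
  apply Subtype.ext
  change !![_, _; _, _] * !![_, _; _, _] * !![_, _; _, _] = !![_, _; _, _]
  have e : Complex.exp (-w / 2) * Complex.exp (-(w / 2)) = Complex.exp (-w) := by
    rw [← Complex.exp_add]; congr 1; ring
  ext i j
  fin_cases i <;> fin_cases j
  · simp [← Complex.exp_add, neg_div]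
  · simp; linear_combination q * e
  · simp
  · simp [← Complex.exp_add, neg_div]

theorem diagExp_conj_lowerUnip (w q : ℂ) :
    diagExp (-w) * lowerUnip q * diagExp w = lowerUnip (Complex.exp w * q) := by
  apply Subtype.ext
  change !![_, _; _, _] * !![_, _; _, _] * !![_, _; _, _] = !![_, _; _, _]
  have e : Complex.exp (-(-w / 2)) * Complex.exp (w / 2) = Complex.exp w := by
    rw [← Complex.exp_add]; congr 1; ring
  ext i j
  fin_cases i <;> fin_cases j
  · simp [← Complex.exp_add, neg_div]
  · simp
  · simp; linear_combination q * e
  · simp [← Complex.exp_add, neg_div]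

theorem continuous_upperUnip : Continuous upperUnip :=
  Continuous.subtype_mk (continuous_matrix fun i j => by
    fin_cases i <;> fin_cases j <;> simp <;> fun_prop) _

theorem continuous_lowerUnip : Continuous lowerUnip :=
  Continuous.subtype_mk (continuous_matrix fun i j => by
    fin_cases i <;> fin_cases j <;> simp <;> fun_prop) _

theorem continuous_diagExp : Continuous diagExp :=
  Continuous.subtype_mk (continuous_matrix fun i j => by
    fin_cases i <;> fin_cases j <;> simp <;> fun_prop) _

theorem continuous_mk : Continuous (QuotientGroup.mk : SL(2, ℂ) → PSL2C) :=
  QuotientGroup.continuous_mk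

/-- Conjugation scales the entry by exp(-t). Only this inclusion is needed, not a description of all
of N⁻. -/
theorem mk_upperUnip_mem (q : ℂ) : (QuotientGroup.mk (upperUnip q) : PSL2C) ∈ Nminus := by
  have h : Tendsto (fun t : ℝ => Complex.exp (-(t : ℂ)) * q) atTop (𝓝 0) := by
    rw [tendsto_zero_iff_norm_tendsto_zero]
    have := Real.tendsto_exp_neg_atTop_nhds_zero.mul_const ‖q‖
    simpa [Complex.norm_exp] using this
  have h1 := ((continuous_mk.comp continuous_upperUnip).tendsto 0).comp h
  have h0 : upperUnip 0 = 1 := Subtype.ext one_fin_two.symm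
  rw [Function.comp_apply, h0] at h1
  refine h1.congr fun t => ?_
  rw [Function.comp_apply, Function.comp_apply, ← diagExp_conj_upperUnip, ← Complex.ofReal_neg]
  rfl

theorem mk_lowerUnip_mem (q : ℂ) : (QuotientGroup.mk (lowerUnip q) : PSL2C) ∈ Nplus := by
  have h : Tendsto (fun t : ℝ => Complex.exp (t : ℂ) * q) atBot (𝓝 0) := by
    rw [tendsto_zero_iff_norm_tendsto_zero]
    have := Real.tendsto_exp_atBot.mul_const ‖q‖
    simpa [Complex.norm_exp] using this
  have h1 := ((continuous_mk.comp continuous_lowerUnip).tendsto 0).comp h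
  have h0 : lowerUnip 0 = 1 := Subtype.ext one_fin_two.symm
  rw [Function.comp_apply, h0] at h1
  refine h1.congr fun t => ?_
  rw [Function.comp_apply, Function.comp_apply, ← diagExp_conj_lowerUnip, ← Complex.ofReal_neg]
  rfl

theorem mk_mem_suppBMS {Γ : Subgroup PSL2C} {P : SL(2, ℂ)} :
    (QuotientGroup.mk P : PSL2C) ∈ suppBMS Γ ↔
      boundaryPt (P • ![1, 0]) ∈ limitSet Γ ∧ boundaryPt (P • ![0, 1]) ∈ limitSet Γ := by
  have h1 : boundaryPt ![1, 0] = ∞ := by simp [boundaryPt]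
  have h0 : boundaryPt ![0, 1] = ((0 : ℂ) : OnePoint ℂ) := by simp [boundaryPt]
  rw [← moebius_mk_boundaryPt P (by simp), ← moebius_mk_boundaryPt P (by simp), h1, h0]
  rfl

theorem mul_mem_suppBMS {Γ : Subgroup PSL2C} {γ g : PSL2C} (hγ : γ ∈ Γ) (hg : g ∈ suppBMS Γ) :
    γ * g ∈ suppBMS Γ := by
  induction γ using QuotientGroup.induction_on with | H γ =>
  induction g using QuotientGroup.induction_on with | H g =>
  rw [← QuotientGroup.mk_mul, mk_mem_suppBMS, mul_smul, mul_smul]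
  rw [mk_mem_suppBMS] at hg
  exact ⟨smul_mem_limitSet hγ ((smul_ne_zero_iff_ne g).2 (by simp)) hg.1,
    smul_mem_limitSet hγ ((smul_ne_zero_iff_ne g).2 (by simp)) hg.2⟩

/-! ### Horospherical moves and reachability -/

/-- `Q` is obtained from `P` by a move along a horosphere, inside the support. -/
def HoroStep (Γ : Subgroup PSL2C) (P Q : SL(2, ℂ)) : Prop :=
  (QuotientGroup.mk P : PSL2C) ∈ suppBMS Γ ∧ (QuotientGroup.mk Q : PSL2C) ∈ suppBMS Γ ∧
    ∃ q, Q = P * upperUnip q ∨ Q = P * lowerUnip q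

theorem HoroStep.symm {Γ : Subgroup PSL2C} {P Q : SL(2, ℂ)} (h : HoroStep Γ P Q) :
    HoroStep Γ Q P := by
  obtain ⟨hP, hQ, q, hq⟩ := h
  refine ⟨hQ, hP, -q, ?_⟩
  rw [upperUnip_neg, lowerUnip_neg, eq_mul_inv_iff_mul_eq, eq_mul_inv_iff_mul_eq]
  exact hq.imp Eq.symm Eq.symm

theorem Reachable.horoStep {Γ : Subgroup PSL2C} {g : PSL2C} {P Q : SL(2, ℂ)}
    (h : Reachable Γ g (QuotientGroup.mk P)) (hPQ : HoroStep Γ P Q) :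
    Reachable Γ g (QuotientGroup.mk Q) := by
  obtain ⟨hg, -, l, γ, hγ, hl, hr, he⟩ := h
  obtain ⟨-, hQ, q, hq⟩ := hPQ
  obtain ⟨n, hn, hQn⟩ : ∃ n ∈ Nminus ∪ Nplus,
      (QuotientGroup.mk Q : PSL2C) = QuotientGroup.mk P * n := by
    rcases hq with rfl | rfl
    · exact ⟨_, Or.inl (mk_upperUnip_mem q), rfl⟩
    · exact ⟨_, Or.inr (mk_lowerUnip_mem q), rfl⟩
  have hprod : γ * g * (l ++ [n]).prod = QuotientGroup.mk Q := by
    rw [List.prod_append, List.prod_singleton, hQn, ← he, mul_assoc, mul_assoc, mul_assoc]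
  refine ⟨hg, hQ, l ++ [n], γ, hγ, fun h hh => ?_, fun r hrl => ?_, hprod⟩
  · rcases List.mem_append.1 hh with hh | hh
    · exact hl h hh
    · rw [List.mem_singleton.1 hh]
      exact hn
  · rw [List.length_append, List.length_singleton] at hrl
    rcases Nat.le_or_eq_of_le_succ hrl with hrl | rfl
    · rw [List.take_append_of_le_length hrl]
      exact hr r hrl
    · rw [List.take_of_length_le (by simp)]
      -- The chain runs from g before γ is applied, so its new end is a Γ-translate of Q, in the
      -- support by invariance.
      have : g * (l ++ [n]).prod = γ⁻¹ * QuotientGroup.mk Q := by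
        rw [← hprod, mul_assoc, inv_mul_cancel_left]
      rw [this]
      exact mul_mem_suppBMS (Γ.inv_mem hγ) hQ

theorem Reachable.trans_horoStep {Γ : Subgroup PSL2C} {g : PSL2C} {P Q : SL(2, ℂ)}
    (h : Reachable Γ g (QuotientGroup.mk P)) (hPQ : Relation.ReflTransGen (HoroStep Γ) P Q) :
    Reachable Γ g (QuotientGroup.mk Q) := by
  induction hPQ with
  | refl => exact h
  | tail _ h' ih => exact ih.horoStep h'

theorem smul_fin_two (g : SL(2, ℂ)) (a b : ℂ) :
    g • ![a, b] = ![g 0 0 * a + g 0 1 * b, g 1 0 * a + g 1 1 * b] := by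
  ext i
  have h2 : ∀ i : Fin 2, i = 0 ∨ i = 1 := by decide
  rcases h2 i with rfl | rfl
  · simp [smul_zero_coord]
  · simp [smul_one_coord]

theorem boundaryPt_mul_smul (P T : SL(2, ℂ)) {v w : Fin 2 → ℂ} {c : ℂ} (hc : c ≠ 0) (hv : v ≠ 0)
    (h : T • w = c • v) : boundaryPt ((P * T) • w) = boundaryPt (P • v) := by
  rw [mul_smul, h, ← moebius_mk_boundaryPt P (smul_ne_zero hc hv), boundaryPt_smul hc,
    moebius_mk_boundaryPt P hv]

theorem upperUnip_smul (q a b : ℂ) : upperUnip q • ![a, b] = ![a + q * b, b] := by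
  rw [smul_fin_two]; simp [upperUnip]

theorem lowerUnip_smul (q a b : ℂ) : lowerUnip q • ![a, b] = ![a, q * a + b] := by
  rw [smul_fin_two]; simp [lowerUnip]

theorem diagExp_smul (w a b : ℂ) :
    diagExp w • ![a, b] = ![Complex.exp (w / 2) * a, Complex.exp (-(w / 2)) * b] := by
  rw [smul_fin_two]; simp [diagExp]

/-! ### The loop of four moves and its periods -/

/-- Moving the two end points `∞` and `0` to `x` and `y` and back, one at a time, results in the
translation by a cross ratio. -/
theorem reflTransGen_horoStep_diagExp {Γ : Subgroup PSL2C} {P : SL(2, ℂ)}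
    (hP : (QuotientGroup.mk P : PSL2C) ∈ suppBMS Γ) {x y w : ℂ} (hx : x ≠ 0) (hxy : x ≠ y)
    (hxΛ : boundaryPt (P • ![x, 1]) ∈ limitSet Γ) (hyΛ : boundaryPt (P • ![y, 1]) ∈ limitSet Γ)
    (hw : Complex.exp (w / 2) * (x - y) = x) :
    Relation.ReflTransGen (HoroStep Γ) P (P * diagExp w) := by
  have hd : x - y ≠ 0 := sub_ne_zero.2 hxy
  obtain ⟨h1, h0⟩ := mk_mem_suppBMS.1 hP
  -- The entries are forced: r sends the forward end to x, q returns the backward end to 0, s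
  -- returns the forward end to ∞.
  set r := (x - y)⁻¹ with hr
  set q := -(y * (x - y) / x) with hq
  set s := -(x * r * r) with hs
  have hexp : Complex.exp (w / 2) = x * r := by rw [hr, ← div_eq_mul_inv, eq_div_iff hd, hw]
  have hexp' : Complex.exp (-(w / 2)) = (x - y) / x := by
    rw [Complex.exp_neg, hexp, hr]; field_simp
  have mem : ∀ (T : SL(2, ℂ)) (v₁ v₀ : Fin 2 → ℂ) (c₁ c₀ : ℂ), v₁ ≠ 0 → v₀ ≠ 0 → c₁ ≠ 0 → c₀ ≠ 0 →
      boundaryPt (P • v₁) ∈ limitSet Γ → boundaryPt (P • v₀) ∈ limitSet Γ →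
      T • ![1, 0] = c₁ • v₁ → T • ![0, 1] = c₀ • v₀ →
      (QuotientGroup.mk (P * T) : PSL2C) ∈ suppBMS Γ := by
    intro T v₁ v₀ c₁ c₀ hv₁ hv₀ hc₁ hc₀ hΛ₁ hΛ₀ e₁ e₀
    rw [mk_mem_suppBMS, boundaryPt_mul_smul P T hc₁ hv₁ e₁, boundaryPt_mul_smul P T hc₀ hv₀ e₀]
    exact ⟨hΛ₁, hΛ₀⟩
  have hr0 : r ≠ 0 := inv_ne_zero hd
  have m1 := mem (upperUnip y) ![1, 0] ![y, 1] 1 1 (by simp) (by simp) one_ne_zero one_ne_zero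
    h1 hyΛ (by simp [upperUnip_smul]) (by simp [upperUnip_smul])
  have m2 := mem (upperUnip y * lowerUnip r) ![x, 1] ![y, 1] r 1 (by simp) (by simp) hr0 one_ne_zero
    hxΛ hyΛ (by
      rw [mul_smul, lowerUnip_smul, upperUnip_smul]
      simp only [smul_cons, smul_empty, smul_eq_mul]
      congr 1
      · rw [hr]; field_simp; ring
      · simp) (by simp [mul_smul, lowerUnip_smul, upperUnip_smul])
  have m3 := mem (upperUnip y * lowerUnip r * upperUnip q) ![x, 1] ![0, 1] r ((x - y) / x) (by simp)
    (by simp) hr0 (div_ne_zero hd hx) hxΛ h0 (by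
      rw [mul_smul, mul_smul, upperUnip_smul, lowerUnip_smul, upperUnip_smul]
      simp only [smul_cons, smul_empty, smul_eq_mul]
      congr 1
      · rw [hr]; field_simp; ring
      · simp) (by
      rw [mul_smul, mul_smul, upperUnip_smul, lowerUnip_smul, upperUnip_smul]
      simp only [smul_cons, smul_empty, smul_eq_mul]
      congr 1
      · rw [hr, hq]; field_simp; ring
      · congr 1
        rw [hr, hq]; field_simp; ring)
  have m4 := mem (diagExp w) ![1, 0] ![0, 1] _ _ (by simp) (by simp) (Complex.exp_ne_zero (w / 2))
    (Complex.exp_ne_zero (-(w / 2))) h1 h0 (by simp [diagExp_smul]) (by simp [diagExp_smul])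
  have e : upperUnip y * lowerUnip r * upperUnip q * lowerUnip s = diagExp w := by
    apply Subtype.ext
    change !![_, _; _, _] * !![_, _; _, _] * !![_, _; _, _] * !![_, _; _, _] = !![_, _; _, _]
    rw [hexp, hexp']
    ext i j
    fin_cases i <;> fin_cases j <;> simp <;> simp only [hs, hq, hr] <;> field_simp <;> ring
  rw [← e] at m4 ⊢
  rw [← mul_assoc] at m2 m3 m4 ⊢
  rw [← mul_assoc] at m3 m4 ⊢
  rw [← mul_assoc] at m4 ⊢
  exact (((Relation.ReflTransGen.single ⟨hP, m1, _, Or.inl rfl⟩).tail ⟨m1, m2, _, Or.inr rfl⟩).tail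
    ⟨m2, m3, _, Or.inl rfl⟩).tail ⟨m3, m4, _, Or.inr rfl⟩

/-- The complex translation lengths `w` such that `P (u + w)` can be reached from `P u` by moves
along horospheres, for all points `P u` of the complex geodesic through `P`. -/
def horoPeriods (Γ : Subgroup PSL2C) (P : SL(2, ℂ)) : AddSubgroup ℂ where
  carrier := {w | ∀ u, Relation.ReflTransGen (HoroStep Γ) (P * diagExp u) (P * diagExp (u + w))}
  zero_mem' u := by rw [add_zero]
  add_mem' {v w} hv hw u := by
    rw [← add_assoc]
    exact (hv u).trans (hw (u + v))
  neg_mem' {w} hw u := by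
    have hu := hw (u + -w)
    rw [neg_add_cancel_right] at hu
    have : Std.Symm (HoroStep Γ) := ⟨fun _ _ h => h.symm⟩
    exact symm hu

/-- Seen from `P * diagExp u`, the two limit points have coordinates exp(-u)x and exp(-u)y. Their
ratio, hence the translation length of the loop, does not depend on u. -/
theorem log_mem_horoPeriods {Γ : Subgroup PSL2C} {P : SL(2, ℂ)}
    (hP : (QuotientGroup.mk P : PSL2C) ∈ suppBMS Γ) {x y : ℂ} (hx : x ≠ 0) (hxy : x ≠ y)
    (hxΛ : boundaryPt (P • ![x, 1]) ∈ limitSet Γ) (hyΛ : boundaryPt (P • ![y, 1]) ∈ limitSet Γ) :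
    -2 * Complex.log (1 - y / x) ∈ horoPeriods Γ P := by
  intro u
  have hu : Complex.exp u * Complex.exp (-u) = 1 := by rw [← Complex.exp_add]; simp
  have key : ∀ z : ℂ, diagExp u • ![Complex.exp (-u) * z, 1] =
      Complex.exp (-(u / 2)) • ![z, 1] := by
    intro z
    rw [diagExp_smul, smul_cons, smul_cons, smul_empty, ← mul_assoc, ← Complex.exp_add]
    congr 3
    ring
  have hd : x - y ≠ 0 := sub_ne_zero.2 hxy
  have h1 : 1 - y / x ≠ 0 := by
    rw [one_sub_div hx]
    exact div_ne_zero hd hx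
  have he : Complex.exp (-u) ≠ 0 := Complex.exp_ne_zero _
  rw [diagExp_add, ← mul_assoc]
  refine reflTransGen_horoStep_diagExp (x := Complex.exp (-u) * x) (y := Complex.exp (-u) * y) ?_
    (mul_ne_zero he hx) (fun h => hxy (mul_left_cancel₀ he h)) ?_ ?_ ?_
  · rw [mk_mem_suppBMS] at hP ⊢
    rw [boundaryPt_mul_smul P (diagExp u) (v := ![1, 0]) (Complex.exp_ne_zero (u / 2)) (by simp)
        (by simp [diagExp_smul]),
      boundaryPt_mul_smul P (diagExp u) (v := ![0, 1]) (Complex.exp_ne_zero (-(u / 2))) (by simp)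
        (by simp [diagExp_smul])]
    exact hP
  · rwa [boundaryPt_mul_smul P (diagExp u) (Complex.exp_ne_zero _) (by simp) (key x)]
  · rwa [boundaryPt_mul_smul P (diagExp u) (Complex.exp_ne_zero _) (by simp) (key y)]
  · rw [show -2 * Complex.log (1 - y / x) / 2 = -Complex.log (1 - y / x) by ring, Complex.exp_neg,
      Complex.exp_log h1]
    field_simp

theorem ofReal_mem_closure_horoPeriods {Γ : Subgroup PSL2C} (hΓ : NonElementary Γ) {P : SL(2, ℂ)}
    (hP : (QuotientGroup.mk P : PSL2C) ∈ suppBMS Γ) (s : ℝ) :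
    (s : ℂ) ∈ closure (horoPeriods Γ P : Set ℂ) := by
  refine ofReal_mem_closure _ (fun ε hε => ?_) s
  obtain ⟨x, hx, y, hy, hx0, hy0, h1, h2⟩ := exists_div_near_pos
    (Y := {y | boundaryPt (P • ![y, 1]) ∈ limitSet Γ}) (fun δ hδ => by
      obtain ⟨y, hy0, hyδ, hy⟩ := exists_small_mem_limitSet hΓ P (mk_mem_suppBMS.1 hP).2 hδ
      exact ⟨y, hy, hy0, hyδ⟩) (ε := min (1 / 4) (ε / 4)) (by positivity)
  obtain ⟨h3, h4, h5⟩ := log_one_sub_near_real (min_le_left _ _) (div_ne_zero hy0 hx0) h1 h2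
  have hε4 : 4 * min (1 / 4) (ε / 4) ≤ ε := by linarith [min_le_right (1 / 4) (ε / 4)]
  refine ⟨_, log_mem_horoPeriods hP hx0 (fun hxy => ?_) hx hy, h3, h4.trans_le hε4,
    h5.trans (by gcongr)⟩
  rw [← hxy, div_self hx0, norm_one] at h1
  linarith [min_le_left (1 / 4) (ε / 4)]

/-! ### The group M × A and the conclusion -/

theorem mk_diagExp_mem_M (θ : ℝ) :
    (QuotientGroup.mk (diagExp (θ * Complex.I)) : PSL2C) ∈ M := by
  refine Subgroup.mem_map.2 ⟨_, ⟨?_, ?_⟩, rfl⟩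
  · change (diagExp (θ * Complex.I)).1 ∈ unitaryGroup (Fin 2) ℂ
    rw [mem_unitaryGroup_iff]
    have h : starRingEnd ℂ (θ * Complex.I / 2) = -(θ * Complex.I / 2) := by
      rw [map_div₀, map_mul, Complex.conj_ofReal, Complex.conj_I, map_ofNat]
      ring
    ext i j
    fin_cases i <;> fin_cases j <;>
      simp [diagExp, mul_apply, Fin.sum_univ_two, star_apply, ← Complex.exp_conj, h,
        ← Complex.exp_add]
  · change (diagExp (θ * Complex.I)).1 * baseVector = baseVector * (diagExp (θ * Complex.I)).1
    change !![_, _; _, _] * !![_, _; _, _] = !![_, _; _, _] * !![_, _; _, _]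
    simp [mul_comm]

theorem exists_diagExp_of_mem_M {m : PSL2C} (hm : m ∈ M) :
    ∃ w, m = QuotientGroup.mk (diagExp w) := by
  obtain ⟨k, ⟨-, hk⟩, rfl⟩ := Subgroup.mem_map.1 hm
  replace hk : k.1 * baseVector = baseVector * k.1 := hk
  have h01 : k 0 1 = 0 := by
    have := congrFun (congrFun hk 0) 1
    simp only [baseVector, mul_apply, Fin.sum_univ_two] at this
    simp at this
    change _ = (_ : ℂ) at this
    linear_combination (-1 : ℂ) * this
  have h10 : k 1 0 = 0 := by
    have := congrFun (congrFun hk 1) 0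
    simp only [baseVector, mul_apply, Fin.sum_univ_two] at this
    simp at this
    linear_combination this
  have hdet := det_eq_one k
  rw [h01, zero_mul, sub_zero] at hdet
  have h00 : k 0 0 ≠ 0 := left_ne_zero_of_mul_eq_one hdet
  refine ⟨2 * Complex.log (k 0 0), congrArg _ (Subtype.ext ?_)⟩
  have e : 2 * Complex.log (k 0 0) / 2 = Complex.log (k 0 0) := by ring
  ext i j
  fin_cases i <;> fin_cases j <;> simp only [diagExp, e]
  · simp [Complex.exp_log h00]
  · simpa using h01
  · simpa using h10
  · simp [Complex.exp_neg, Complex.exp_log h00]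
    exact eq_inv_of_mul_eq_one_right hdet

/-- The element of `M × A` with complex translation length `w`. -/
def elliptHyp (w : ℂ) : M × A :=
  (⟨_, mk_diagExp_mem_M w.im⟩, ⟨aElt w.re, w.re, rfl⟩)

theorem continuous_elliptHyp : Continuous elliptHyp :=
  Continuous.prodMk
    (Continuous.subtype_mk (continuous_mk.comp (continuous_diagExp.comp (by fun_prop))) _)
    (Continuous.subtype_mk (continuous_mk.comp (continuous_diagExp.comp
      (Complex.continuous_ofReal.comp Complex.continuous_re))) _)

/-- The product of the components of x is a single `diagExp u`, so the frame reached lies on the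
complex geodesic through `P`, where the period v applies. -/
theorem mul_elliptHyp_mem {Γ : Subgroup PSL2C} {P : SL(2, ℂ)} {x : M × A}
    (hx : x ∈ transitivityGroup Γ (QuotientGroup.mk P)) {v : ℂ} (hv : v ∈ horoPeriods Γ P) :
    x * elliptHyp v ∈ transitivityGroup Γ (QuotientGroup.mk P) := by
  obtain ⟨⟨m, hm⟩, ⟨_, t, rfl⟩⟩ := x
  obtain ⟨w, rfl⟩ := exists_diagExp_of_mem_M hm
  change Reachable Γ (QuotientGroup.mk P) (QuotientGroup.mk (P * diagExp w * diagExp t)) at hx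
  change Reachable Γ (QuotientGroup.mk P) (QuotientGroup.mk (P * (diagExp w *
    diagExp (v.im * Complex.I)) * (diagExp t * diagExp v.re)))
  have e : P * (diagExp w * diagExp (v.im * Complex.I)) * (diagExp t * diagExp v.re) =
      P * diagExp (w + t + v) := by
    rw [mul_assoc, ← diagExp_add, ← diagExp_add, ← diagExp_add]
    congr 2
    conv_rhs => rw [← Complex.re_add_im v]
    ring
  rw [e]
  rw [mul_assoc, ← diagExp_add] at hx
  exact hx.trans_horoStep (hv _)

theorem closure_transitivityGroup {Γ : Subgroup PSL2C} (hΓ : NonElementary Γ) (g : PSL2C)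
    (hg : g ∈ suppBMS Γ) :
    closure (transitivityGroup Γ g) =
      closure (weakTransitivityGroup Γ g) ×ˢ (Set.univ : Set A) := by
  induction g using QuotientGroup.induction_on with | H P =>
  rw [← closure_univ (X := A), ← closure_prod_eq]
  refine subset_antisymm (closure_mono fun x hx => ⟨⟨x, hx, rfl⟩, trivial⟩)
    (closure_minimal ?_ isClosed_closure)
  rintro ⟨m, a'⟩ ⟨⟨⟨m', a⟩, hx, hm'⟩, -⟩
  obtain rfl : m' = m := hm'
  obtain ⟨s, hs⟩ := (a⁻¹ * a').2
  -- A real length s gives no rotation, so only the A-component moves; s is then approximated by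
  -- periods.
  have hlim : (m', a') = (m', a) * elliptHyp s := by
    have hm : (elliptHyp s).1 = 1 := by
      refine Subtype.ext ?_
      change (QuotientGroup.mk (diagExp ((s : ℂ).im * Complex.I)) : PSL2C) = 1
      rw [Complex.ofReal_im, Complex.ofReal_zero, zero_mul, ← Complex.ofReal_zero,
        ← aMat_eq_diagExp, aMat_zero]
      rfl
    have ha : (elliptHyp s).2 = a⁻¹ * a' := Subtype.ext hs
    refine Prod.ext ?_ ?_
    · rw [Prod.fst_mul, hm, mul_one]
    · rw [Prod.snd_mul, ha, mul_inv_cancel_left]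
  rw [hlim]
  have hc : Continuous fun v => (m', a) * elliptHyp v := continuous_elliptHyp.const_mul (m', a)
  have hmaps : Set.MapsTo (fun v => (m', a) * elliptHyp v) (horoPeriods Γ (P : SL(2, ℂ)))
      (transitivityGroup Γ (QuotientGroup.mk P)) := fun v hv => mul_elliptHyp_mem hx hv
  have := map_mem_closure hc (ofReal_mem_closure_horoPeriods hΓ hg s) hmaps
  exact this

end

end FrameFlow

theorem mainTheorem10 (Γ : Subgroup FrameFlow.PSL2C) [DiscreteTopology Γ]
    (hΓ : FrameFlow.NonElementary Γ)
    (g : FrameFlow.PSL2C) (hg : g ∈ FrameFlow.suppBMS Γ) :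
    closure (FrameFlow.transitivityGroup Γ g) =
      closure (FrameFlow.weakTransitivityGroup Γ g) ×ˢ (Set.univ : Set FrameFlow.A) :=
  FrameFlow.closure_transitivityGroup hΓ g hg
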